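/- Let $\mathcal A$ be a finite alphabet and let $\mathcal A^*$ be the free monoid of finite words over $\mathcal A$. A map $\varphi:\mathcal A^*\to\mathcal A^*$ is a morphism if $\varphi(vw)=\varphi(v)\varphi(w)$ for all $v,w$, and an antimorphism if $\varphi(vw)=\varphi(w)\varphi(v)$ for all $v,w$. Let $G$ be a finite group under composition, with the identity map as unit, consisting of morphisms and antimorphisms of $\mathcal A^*$ and containing at least one antimorphism. For $w\in\mathcal A^*$ put $[w]=\{\mu(w):\mu\in G\}$. Let $\mathbf u\in\mathcal A^{\mathbb N}$ be an infinite word in which every letter of $\mathcal A$ occurs, and let $\mathcal L(\mathbf u)$ be the set of its finite factors. It is closed under $G$ if $\mu(w)\in\mathcal L(\mathbf u)$ for all $w\in\mathcal L(\mathbf u)$, $\mu\in G$. A factor $w\in\mathcal L(\mathbf u)$ is special if there are at least two letters $a$ with $aw\in\mathcal L(\mathbf u)$ or at least two letters $a$ with $wa\in\mathcal L(\mathbf u)$. When $\mathcal L(\mathbf u)$ is closed under $G$, the graph of symmetries $\Gamma_n(\mathbf u)$ is the undirected multigraph (loops and multiple edges allowed) whose vertices are the classes $[w]$ of the special factors $w$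 of length $n$, and whose edges are the classes $[e]$ of the factors $e\in\mathcal L(\mathbf u)$ of length at least $n+1$ such that the prefix and the suffix of $e$ of length $n$ are special and no other occurrence in $e$ of a factor of length $n$ is special; the edge $[e]$ joins the class of the prefix of $e$ of length $n$ to the class of the suffix of $e$ of length $n$. The word $\mathbf u$ is almost $G$-rich if there is $N\in\mathbb N$ such that for every $n\ge N$: $\mathcal L(\mathbf u)$ is closed under $G$; for every loop $[e]$ of $\Gamma_n(\mathbf u)$ there is an antimorphism $\Theta\in G$ with $\Theta(e)=e$; and the graph obtained from $\Gamma_n(\mathbf u)$ by removing all loops is a tree (in particular it has no multiple edges; the graph without vertices is allowed). Theorem. If there exists an almost $G$-rich infinite word $\mathbf u\in\mathcal A^{\mathbb N}$ in which every letter of $\mathcal A$ occurs, then $G$ is generated by the set $\{\Theta\in G:\Theta\text{ is an antimorphism and }\Theta^2=\mathrm{Id}\}$ of its involutive antimorphisms. -/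

import Mathlib

/-! Finite words over `A` are lists, i.e. elements of the free monoid on `A` with concatenation
`++`; infinite words are sequences `u : ℕ → A`. -/

namespace GRich

variable {A : Type*}

/-! ### Morphisms, antimorphisms and groups of symmetries -/

/-- `φ(vw) = φ(v)φ(w)` for all words `v, w`. -/
def IsMorphism (φ : List A → List A) : Prop :=
  ∀ v w : List A, φ (v ++ w) = φ v ++ φ w

/-- `φ(vw) = φ(w)φ(v)` for all words `v, w`. -/
def IsAntimorphism (φ : List A → List A) : Prop :=
  ∀ v w : List A, φ (v ++ w) = φ w ++ φ v

/-- A finite group (under composition) of morphisms and antimorphisms of the free monoid,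
containing at least one antimorphism. -/
structure IsSymmetryGroup (G : Subgroup (Equiv.Perm (List A))) : Prop where
  finite : Finite G
  morphism_or_antimorphism : ∀ φ ∈ G, IsMorphism φ ∨ IsAntimorphism φ
  exists_antimorphism : ∃ φ ∈ G, IsAntimorphism φ

/-- The set `G⁽²⁾` of involutive antimorphisms belonging to `G`. -/
def involutiveAntimorphisms (G : Subgroup (Equiv.Perm (List A))) :
    Set (Equiv.Perm (List A)) :=
  {Θ | Θ ∈ G ∧ IsAntimorphism Θ ∧ Function.Involutive Θ}

/-- The class `[w]` of words `G`-equivalent to `w`. -/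
def gClass (G : Subgroup (Equiv.Perm (List A))) (w : List A) : Set (List A) :=
  {v | ∃ μ ∈ G, v = μ w}

/-- `w` is a `Θ`-palindrome for some antimorphism `Θ ∈ G`. -/
def IsGPalindrome (G : Subgroup (Equiv.Perm (List A))) (w : List A) : Prop :=
  ∃ Θ ∈ G, IsAntimorphism Θ ∧ Θ w = w

/-! ### Factors of an infinite word -/

/-- The word `u_i u_{i+1} ⋯ u_{i+n-1}`. -/
def factorAt (u : ℕ → A) (i n : ℕ) : List A :=
  (List.range n).map fun j => u (i + j)

/-- The language of `u`: the set of all its factors. -/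
def language (u : ℕ → A) : Set (List A) :=
  {w | ∃ i : ℕ, w = factorAt u i w.length}

/-- The language of `u` is closed under `G`. -/
def ClosedUnder (G : Subgroup (Equiv.Perm (List A))) (u : ℕ → A) : Prop :=
  ∀ w ∈ language u, ∀ μ ∈ G, μ w ∈ language u

/-- The set of left extensions of `w` in `u`. -/
def leftExt (u : ℕ → A) (w : List A) : Set A :=
  {a | a :: w ∈ language u}

/-- The set of right extensions of `w` in `u`. -/
def rightExt (u : ℕ → A) (w : List A) : Set A :=
  {a | w ++ [a] ∈ language u}

/-- `w` is a factor of `u` that is left or right special: it has at least two left extensions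
or at least two right extensions. -/
def IsSpecial (u : ℕ → A) (w : List A) : Prop :=
  w ∈ language u ∧ ((leftExt u w).Nontrivial ∨ (rightExt u w).Nontrivial)

/-! ### Graphs of symmetries -/

/-- The prefix of `e` of length `n` (for `n ≤ |e|`). -/
def prefixWord (n : ℕ) (e : List A) : List A := e.take n

/-- The suffix of `e` of length `n` (for `n ≤ |e|`). -/
def suffixWord (n : ℕ) (e : List A) : List A := e.drop (e.length - n)

/-- The vertices of the graphs of symmetries of order `n`: the classes `[w]` of the special
factors `w` of length `n`. -/
def vertices (G : Subgroup (Equiv.Perm (List A))) (u : ℕ → A) (n : ℕ) :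
    Set (Set (List A)) :=
  {x | ∃ w : List A, w.length = n ∧ IsSpecial u w ∧ x = gClass G w}

/-- The edges of the directed graph of symmetries of order `n`: the factors `e` of `u` of length
at least `n + 1` whose prefix and suffix of length `n` are special, while no other factor of
length `n` of `e` (starting at a position `0 < i < |e| - n`) is special. -/
def directedEdges (u : ℕ → A) (n : ℕ) : Set (List A) :=
  {e | e ∈ language u ∧ n + 1 ≤ e.length ∧
    IsSpecial u (prefixWord n e) ∧ IsSpecial u (suffixWord n e) ∧
    ∀ i : ℕ, 0 < i → i < e.length - n → ¬ IsSpecial u ((e.drop i).take n)}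

/-- The directed edge `e` starts in `x` and ends in `y`. -/
def StartsEnds (u : ℕ → A) (n : ℕ) (e : List A) (x y : Set (List A)) : Prop :=
  e ∈ directedEdges u n ∧ prefixWord n e ∈ x ∧ suffixWord n e ∈ y

/-- In the undirected graph of symmetries `Γ_n(u)`, the edge `E` joins the vertices `x` and `y`:
`E = [e]` for some `e` that starts in `x` and ends in `y` or vice versa. The edges of this
multigraph are classes of words, and distinct classes are distinct edges, even when they
join the same vertices. -/
def Links (G : Subgroup (Equiv.Perm (List A))) (u : ℕ → A) (n : ℕ)
    (E : Set (List A)) (x y : vertices G u n) : Prop :=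
  ∃ e : List A, E = gClass G e ∧ (StartsEnds u n e x y ∨ StartsEnds u n e y x)

/-- The simple graph underlying `Γ_n(u)`: loops are removed and the multiplicities of edges
are forgotten. -/
def underlyingGraph (G : Subgroup (Equiv.Perm (List A))) (u : ℕ → A) (n : ℕ) :
    SimpleGraph (vertices G u n) where
  Adj x y := x ≠ y ∧ ∃ E : Set (List A), Links G u n E x y
  symm := ⟨by
    rintro x y ⟨hxy, E, e, hE, he⟩
    exact ⟨hxy.symm, E, e, hE, he.symm⟩⟩
  loopless := ⟨fun _ h => h.1 rfl⟩

/-- The multigraph obtained from `Γ_n(u)` by removing loops is a tree: it has no multiple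
edges, it is connected and it has no cycles. The graph without vertices, which occurs exactly
when `u` has no special factor of length `n`, is allowed. -/
def LooplessIsTree (G : Subgroup (Equiv.Perm (List A))) (u : ℕ → A) (n : ℕ) : Prop :=
  (∀ (x y : vertices G u n) (E F : Set (List A)), x ≠ y →
      Links G u n E x y → Links G u n F x y → E = F) ∧
    (underlyingGraph G u n).Preconnected ∧ (underlyingGraph G u n).IsAcyclic

/-- Every loop `[e]` of `Γ_n(u)` consists of `G`-palindromes. -/
def LoopsArePalindromes (G : Subgroup (Equiv.Perm (List A))) (u : ℕ → A) (n : ℕ) : Prop :=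
  ∀ (x : vertices G u n) (e : List A), StartsEnds u n e x x → IsGPalindrome G e

/-- Property `G`-tls(`N`) (tree-like structure). -/
def PropertyTls (G : Subgroup (Equiv.Perm (List A))) (N : ℕ) (u : ℕ → A) : Prop :=
  ∀ n : ℕ, N ≤ n →
    ClosedUnder G u ∧ LoopsArePalindromes G u n ∧ LooplessIsTree G u n

/-- `u` is almost `G`-rich. -/
def IsAlmostRich (G : Subgroup (Equiv.Perm (List A))) (u : ℕ → A) : Prop :=
  ∃ N : ℕ, PropertyTls G N u

end GRich

/-!
Let `w` be a special factor of `u` that contains every letter and has length at least `N`. The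
words of the class of `w` occur along `u` one after another. By recurrence
(`IsSymmetryGroup.exists_occurrence`) `μ w` occurs after `w` for every `μ ∈ G`, and a symmetry fixing
a word with all letters is the identity or an involutive antimorphism
(`IsSymmetryGroup.mem_closure_of_fixes`). It is therefore enough that consecutive occurrences of
words of the class are exchanged by an antimorphism `Θ ∈ G` fixing the factor `f` they delimit,
since such a `Θ` is an involution, all letters occurring in `f`.

That `f` is a `G`-palindrome (`isGPalindrome_of_return`) comes from the tree structure. Seen in the
graph of symmetries of order `|w|`, `f` is a walk from the vertex `[w]` back to it without visiting
it in between. Either it is a loop, which is a palindrome by hypothesis, or, in a tree, it leaves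
and re-enters `[w]` through the same edge, traversed in opposite directions
(`palindrome_or_longer`). Then an antimorphism maps a prefix of `f` longer than `w` to a suffix of
`f`. One prolongs this prefix as long as letters agree; where they disagree, the prefix is a longer
special factor and the graph of a higher order applies (`isGPalindrome_of_antimorphism`).

If no such `w` exists, a long prefix of `u` with all letters determines what follows it, so that
every antimorphism of `G` fixes a prefix of `u` with all letters and is an involution
(`mem_involutiveAntimorphisms_of_not_special`); and every morphism in `G` is a product of two
antimorphisms.
-/

namespace GRich

variable {A : Type*}

/-! ### Factors of an infinite word -/

@[simp]
theorem length_factorAt (u : ℕ → A) (i n : ℕ) : (factorAt u i n).length = n := by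
  simp [factorAt]

theorem factorAt_add (u : ℕ → A) (i m n : ℕ) :
    factorAt u i (m + n) = factorAt u i m ++ factorAt u (i + m) n := by
  simp [factorAt, List.range_add, Function.comp_def, add_assoc]

theorem factorAt_one (u : ℕ → A) (i : ℕ) : factorAt u i 1 = [u i] := by
  simp [factorAt]

theorem factorAt_succ (u : ℕ → A) (i n : ℕ) :
    factorAt u i (n + 1) = factorAt u i n ++ [u (i + n)] := by
  rw [factorAt_add, factorAt_one]

theorem factorAt_succ' (u : ℕ → A) (i n : ℕ) :
    factorAt u i (n + 1) = u i :: factorAt u (i + 1) n := by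
  rw [add_comm, factorAt_add, factorAt_one]; rfl

theorem factorAt_mem_language (u : ℕ → A) (i n : ℕ) : factorAt u i n ∈ language u :=
  ⟨i, by simp⟩

theorem take_drop_factorAt (u : ℕ → A) {i n a m : ℕ} (h : a + m ≤ n) :
    ((factorAt u i n).drop a).take m = factorAt u (i + a) m := by
  obtain ⟨c, rfl⟩ := Nat.exists_eq_add_of_le h
  rw [factorAt_add, factorAt_add, List.append_assoc, List.drop_left' (by simp),
    List.take_left' (by simp)]

/-- Equal factors have equal subfactors at the same relative position. -/
theorem factorAt_sub_eq {u : ℕ → A} {i j n : ℕ} (h : factorAt u i n = factorAt u j n)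
    {a m : ℕ} (ham : a + m ≤ n) : factorAt u (i + a) m = factorAt u (j + a) m := by
  rw [← take_drop_factorAt u ham, h, take_drop_factorAt u ham]

theorem exists_forall_mem_factorAt [Finite A] {u : ℕ → A} (hu : Function.Surjective u) (N : ℕ) :
    ∃ n, N ≤ n ∧ ∀ a, a ∈ factorAt u 0 n := by
  choose f hf using hu
  obtain ⟨b, hb⟩ := (Set.finite_range f).bddAbove
  refine ⟨max N (b + 1), le_max_left _ _, fun a => ?_⟩
  have : f a ≤ b := hb ⟨a, rfl⟩
  simp only [factorAt, List.mem_map, List.mem_range]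
  exact ⟨f a, by omega, by simp [hf]⟩

/-! ### Bijective morphisms and antimorphisms -/

theorem IsMorphism.inv {φ : Equiv.Perm (List A)} (h : IsMorphism φ) :
    IsMorphism (φ⁻¹ : Equiv.Perm (List A)) := fun v w => by
  apply φ.injective
  rw [h]; simp

theorem IsAntimorphism.inv {φ : Equiv.Perm (List A)} (h : IsAntimorphism φ) :
    IsAntimorphism (φ⁻¹ : Equiv.Perm (List A)) := fun v w => by
  apply φ.injective
  rw [h]; simp

variable {G : Subgroup (Equiv.Perm (List A))} {u : ℕ → A}

namespace IsSymmetryGroup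

theorem map_nil (hG : IsSymmetryGroup G) {μ : Equiv.Perm (List A)} (hμ : μ ∈ G) :
    μ [] = [] := by
  have : (μ ([] ++ [])).length = (μ []).length + (μ []).length := by
    rcases hG.morphism_or_antimorphism μ hμ with h | h <;> rw [h, List.length_append]
  rw [List.append_nil] at this
  exact List.length_eq_zero_iff.1 (by omega)

theorem length_le (hG : IsSymmetryGroup G) {μ : Equiv.Perm (List A)} (hμ : μ ∈ G)
    (w : List A) : w.length ≤ (μ w).length := by
  induction w with
  | nil => simp
  | cons a w ih =>
    have h1 : μ [a] ≠ [] := fun h => by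
      have := μ.injective (h.trans (hG.map_nil hμ).symm)
      simp at this
    have h2 : (μ ([a] ++ w)).length = (μ [a]).length + (μ w).length := by
      rcases hG.morphism_or_antimorphism μ hμ with h | h <;> rw [h, List.length_append]
      omega
    have := List.length_pos_iff.2 h1
    rw [List.singleton_append] at h2
    rw [h2, List.length_cons]
    omega

theorem length_map (hG : IsSymmetryGroup G) {μ : Equiv.Perm (List A)} (hμ : μ ∈ G)
    (w : List A) : (μ w).length = w.length := by
  refine le_antisymm ?_ (hG.length_le hμ w)
  simpa using hG.length_le (G.inv_mem hμ) (μ w)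

theorem exists_letter (hG : IsSymmetryGroup G) {μ : Equiv.Perm (List A)} (hμ : μ ∈ G)
    (a : A) : ∃ b, μ [a] = [b] :=
  List.length_eq_one_iff.1 (by simpa using hG.length_map hμ [a])

/-- Symmetries map words containing all letters to words containing all letters. -/
theorem forall_mem_map (hG : IsSymmetryGroup G) {μ : Equiv.Perm (List A)} (hμ : μ ∈ G)
    {w : List A} (hw : ∀ a, a ∈ w) (a : A) : a ∈ μ w := by
  obtain ⟨b, hb⟩ := hG.exists_letter (G.inv_mem hμ) a
  have hb' : μ [b] = [a] := by rw [← hb]; simp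
  obtain ⟨s, t, rfl⟩ := List.append_of_mem (hw b)
  have : s ++ b :: t = s ++ ([b] ++ t) := rfl
  rw [this]
  rcases hG.morphism_or_antimorphism μ hμ with h | h <;> rw [h, h, hb'] <;> simp

theorem eq_one_of_morphism (hG : IsSymmetryGroup G) {μ : Equiv.Perm (List A)} (hμ : μ ∈ G)
    (hm : IsMorphism μ) {w : List A} (hw : ∀ a, a ∈ w) (h : μ w = w) : μ = 1 := by
  have hl : ∀ a, μ [a] = [a] := fun a => by
    obtain ⟨s, t, rfl⟩ := List.append_of_mem (hw a)
    have e : s ++ a :: t = s ++ ([a] ++ t) := rfl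
    rw [e, hm, hm] at h
    have h1 := (List.append_inj h (hG.length_map hμ s)).2
    exact (List.append_inj h1 (hG.length_map hμ [a])).1
  ext1 v
  induction v with
  | nil => exact hG.map_nil hμ
  | cons a v ih =>
    have := hm [a] v
    rw [hl, ih] at this
    exact this

theorem mem_involutiveAntimorphisms (hG : IsSymmetryGroup G) {μ : Equiv.Perm (List A)}
    (hμ : μ ∈ G) (hm : IsAntimorphism μ) {w : List A} (hw : ∀ a, a ∈ w) (h : μ w = w) :
    μ ∈ involutiveAntimorphisms G := by
  have : μ * μ = 1 := by
    refine hG.eq_one_of_morphism (G.mul_mem hμ hμ) (fun v w => ?_) hw ?_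
    · simp only [Equiv.Perm.mul_apply]
      rw [hm, hm]
    · simp [h]
  exact ⟨hμ, hm, fun v => by simpa using DFunLike.congr_fun this v⟩

/-- A symmetry fixing a word that contains all letters is the identity or an involutive
antimorphism. -/
theorem mem_closure_of_fixes (hG : IsSymmetryGroup G) {μ : Equiv.Perm (List A)}
    (hμ : μ ∈ G) {w : List A} (hw : ∀ a, a ∈ w) (h : μ w = w) :
    μ ∈ Subgroup.closure (involutiveAntimorphisms G) := by
  rcases hG.morphism_or_antimorphism μ hμ with hm | hm
  · rw [hG.eq_one_of_morphism hμ hm hw h]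
    exact one_mem _
  · exact Subgroup.subset_closure (hG.mem_involutiveAntimorphisms hμ hm hw h)

/-! ### Symmetries acting on the language -/

theorem exists_factorAt (hG : IsSymmetryGroup G) (hcl : ClosedUnder G u)
    {μ : Equiv.Perm (List A)} (hμ : μ ∈ G) (i n : ℕ) :
    ∃ j, μ (factorAt u i n) = factorAt u j n := by
  obtain ⟨j, hj⟩ := hcl _ (factorAt_mem_language u i n) μ hμ
  rw [hG.length_map hμ, length_factorAt] at hj
  exact ⟨j, hj⟩

theorem morphism_split (hG : IsSymmetryGroup G) {μ : Equiv.Perm (List A)} (hμ : μ ∈ G)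
    (hm : IsMorphism μ) {i j a b : ℕ} (h : μ (factorAt u i (a + b)) = factorAt u j (a + b)) :
    μ (factorAt u i a) = factorAt u j a ∧
      μ (factorAt u (i + a) b) = factorAt u (j + a) b := by
  rw [factorAt_add, factorAt_add, hm] at h
  exact List.append_inj h (by simp [hG.length_map hμ])

theorem antimorphism_split (hG : IsSymmetryGroup G) {μ : Equiv.Perm (List A)} (hμ : μ ∈ G)
    (hm : IsAntimorphism μ) {i j a b : ℕ}
    (h : μ (factorAt u i (a + b)) = factorAt u j (a + b)) :
    μ (factorAt u i a) = factorAt u (j + b) a ∧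
      μ (factorAt u (i + a) b) = factorAt u j b := by
  rw [factorAt_add, add_comm a b, factorAt_add, hm] at h
  exact (List.append_inj h (by simp [hG.length_map hμ])).symm

theorem isSpecial_map (hG : IsSymmetryGroup G) (hcl : ClosedUnder G u)
    {μ : Equiv.Perm (List A)} (hμ : μ ∈ G) {w : List A} (hw : IsSpecial u w) :
    IsSpecial u (μ w) := by
  choose σ hσ using fun a => hG.exists_letter hμ a
  have hinj : ∀ {a b}, a ≠ b → σ a ≠ σ b := fun {a b} hab h => hab <| by
    have := μ.injective ((hσ a).trans ((congrArg (fun c => [c]) h).trans (hσ b).symm))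
    simpa using this
  refine ⟨hcl _ hw.1 μ hμ, ?_⟩
  have hl : ∀ {a}, a ∈ leftExt u w → μ ([a] ++ w) ∈ language u := fun ha => hcl _ ha μ hμ
  have hr : ∀ {a}, a ∈ rightExt u w → μ (w ++ [a]) ∈ language u := fun ha => hcl _ ha μ hμ
  rcases hG.morphism_or_antimorphism μ hμ with hm | hm
  · simp only [hm _ _, hσ] at hl hr
    rcases hw.2 with ⟨a, ha, b, hb, hab⟩ | ⟨a, ha, b, hb, hab⟩
    · exact Or.inl ⟨_, hl ha, _, hl hb, hinj hab⟩
    · exact Or.inr ⟨_, hr ha, _, hr hb, hinj hab⟩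
  · simp only [hm _ _, hσ] at hl hr
    rcases hw.2 with ⟨a, ha, b, hb, hab⟩ | ⟨a, ha, b, hb, hab⟩
    · exact Or.inr ⟨_, hl ha, _, hl hb, hinj hab⟩
    · exact Or.inl ⟨_, hr ha, _, hr hb, hinj hab⟩

/-! ### Recurrence -/

/-- Every prefix of `u` occurs again: its image under an antimorphism of `G` can be extended
to the right, so that the prefix itself can be extended to the left. -/
theorem exists_pos_factorAt_eq (hG : IsSymmetryGroup G) (hcl : ClosedUnder G u) (n : ℕ) :
    ∃ j, 0 < j ∧ factorAt u j n = factorAt u 0 n := by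
  obtain ⟨Θ, hΘ, ha⟩ := hG.exists_antimorphism
  obtain ⟨k, hk⟩ := hG.exists_factorAt hcl hΘ 0 n
  obtain ⟨j, hj⟩ := hG.exists_factorAt hcl (G.inv_mem hΘ) k (n + 1)
  have := (hG.antimorphism_split (G.inv_mem hΘ) ha.inv hj).1
  rw [← hk, Equiv.Perm.coe_inv, Equiv.symm_apply_apply] at this
  exact ⟨j + 1, j.succ_pos, this.symm⟩

theorem exists_prefix_occurrence (hG : IsSymmetryGroup G) (hcl : ClosedUnder G u) (K : ℕ) :
    ∀ n, ∃ j, K ≤ j ∧ factorAt u j n = factorAt u 0 n := by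
  induction K with
  | zero => exact fun n => ⟨0, le_rfl, rfl⟩
  | succ K ih =>
    intro n
    obtain ⟨j, hj, h⟩ := ih n
    obtain ⟨l, hl, h'⟩ := hG.exists_pos_factorAt_eq hcl (j + n)
    refine ⟨l + j, by omega, ?_⟩
    rw [factorAt_sub_eq h' le_rfl, Nat.zero_add, h]

/-- A word whose language is closed under `G` is recurrent. -/
theorem exists_occurrence (hG : IsSymmetryGroup G) (hcl : ClosedUnder G u) (K i n : ℕ) :
    ∃ j, K ≤ j ∧ factorAt u j n = factorAt u i n := by
  obtain ⟨j, hj, h⟩ := hG.exists_prefix_occurrence hcl K (i + n)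
  refine ⟨j + i, by omega, ?_⟩
  rw [factorAt_sub_eq h le_rfl, Nat.zero_add]

end IsSymmetryGroup

/-! ### Walks in the graph of symmetries -/

/-- In an acyclic graph, a walk that avoids `x` and joins two neighbours of `x` is closed. -/
theorem eq_of_walk_avoiding {V : Type*} {Γ : SimpleGraph V} (hΓ : Γ.IsAcyclic) {x a b : V}
    (ha : Γ.Adj a x) (hb : Γ.Adj x b) (p : Γ.Walk a b) (hp : x ∉ p.support) : a = b := by
  classical
  by_contra hab
  have hq : (SimpleGraph.Walk.cons ha (SimpleGraph.Walk.cons hb .nil)).IsPath := by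
    simp [SimpleGraph.Walk.cons_isPath_iff, ha.ne, hb.ne, hab]
  have hpq : SimpleGraph.Walk.cons ha (SimpleGraph.Walk.cons hb .nil) = p.bypass :=
    congrArg Subtype.val ((hΓ.subsingleton_path a b).elim ⟨_, hq⟩ ⟨p.bypass, p.bypass_isPath⟩)
  apply hp
  apply p.support_bypass_subset_support
  rw [← hpq]
  simp

theorem self_mem_gClass (w : List A) : w ∈ gClass G w := ⟨1, G.one_mem, rfl⟩

theorem gClass_eq_of_mem {v w : List A} (h : v ∈ gClass G w) : gClass G v = gClass G w := by
  obtain ⟨μ, hμ, rfl⟩ := h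
  ext x
  constructor
  · rintro ⟨ν, hν, rfl⟩
    exact ⟨ν * μ, G.mul_mem hν hμ, rfl⟩
  · rintro ⟨ν, hν, rfl⟩
    exact ⟨ν * μ⁻¹, G.mul_mem hν (G.inv_mem hμ), by simp⟩

/-- The vertex of the graph of symmetries of order `m` visited by `u` at a position `i` at which
a special factor of length `m` occurs. -/
def vertexAt (G : Subgroup (Equiv.Perm (List A))) {u : ℕ → A} {m i : ℕ}
    (h : IsSpecial u (factorAt u i m)) : vertices G u m :=
  ⟨gClass G (factorAt u i m), _, by simp, h, rfl⟩

/-- Two consecutive occurrences of special factors of length `m` delimit an edge. -/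
theorem startsEnds_factorAt {m i d : ℕ} (hd : 0 < d)
    (hi : IsSpecial u (factorAt u i m)) (hj : IsSpecial u (factorAt u (i + d) m))
    (hn : ∀ x, 0 < x → x < d → ¬ IsSpecial u (factorAt u (i + x) m)) :
    StartsEnds u m (factorAt u i (d + m)) (vertexAt G hi) (vertexAt G hj) := by
  have hp : prefixWord m (factorAt u i (d + m)) = factorAt u i m := by
    simpa [prefixWord] using take_drop_factorAt u (i := i) (a := 0) (m := m) (n := d + m) (by omega)
  have hs : suffixWord m (factorAt u i (d + m)) = factorAt u (i + d) m := by
    have := take_drop_factorAt u (i := i) (a := d) (m := m) (n := d + m) le_rfl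
    rw [List.take_of_length_le (by simp)] at this
    simpa [suffixWord] using this
  refine ⟨⟨factorAt_mem_language _ _ _, by simp; omega, by rwa [hp], by rwa [hs], ?_⟩, ?_, ?_⟩
  · intro x hx hxd
    rw [length_factorAt] at hxd
    rw [take_drop_factorAt u (by omega)]
    exact hn x hx (by omega)
  · rw [hp]; exact self_mem_gClass _
  · rw [hs]; exact self_mem_gClass _

/-- A segment of `u` between two special factors yields a walk in the graph of symmetries, which
avoids a vertex `x` if no special factor occurring in the segment lies in `x`. -/
theorem exists_walk_avoiding {m : ℕ} (x : vertices G u m) (d : ℕ) :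
    ∀ {i : ℕ} (hi : IsSpecial u (factorAt u i m)) (hj : IsSpecial u (factorAt u (i + d) m)),
      (∀ y ≤ d, factorAt u (i + y) m ∉ x.1) →
      ∃ p : (underlyingGraph G u m).Walk (vertexAt G hi) (vertexAt G hj), x ∉ p.support := by
  classical
  induction d using Nat.strong_induction_on with
  | _ d ih =>
    intro i hi hj hx
    have hxi : x ≠ vertexAt G hi := by
      rintro rfl
      exact hx 0 (Nat.zero_le _) (self_mem_gClass _)
    rcases Nat.eq_zero_or_pos d with rfl | hd
    · exact ⟨.nil, by simpa using hxi⟩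
    have hex : ∃ s, 0 < s ∧ IsSpecial u (factorAt u (i + s) m) := ⟨d, hd, hj⟩
    obtain ⟨hs0, hs⟩ := Nat.find_spec hex
    have hsd : Nat.find hex ≤ d := Nat.find_min' hex ⟨hd, hj⟩
    have hmin : ∀ y, 0 < y → y < Nat.find hex → ¬ IsSpecial u (factorAt u (i + y) m) :=
      fun y hy hlt h => Nat.find_min hex hlt ⟨hy, h⟩
    generalize Nat.find hex = s at hs0 hs hsd hmin
    have hE := startsEnds_factorAt (G := G) hs0 hi hs hmin
    obtain ⟨c, rfl⟩ := Nat.exists_eq_add_of_le hsd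
    have hj' : IsSpecial u (factorAt u (i + s + c) m) := by rwa [add_assoc]
    have hv : vertexAt G hj' = vertexAt G hj := by
      simp only [vertexAt, add_assoc]
    obtain ⟨p, hp⟩ := ih c (by omega) hs hj' fun y hy => by
      rw [add_assoc]; exact hx _ (by omega)
    rw [← hv]
    by_cases he : vertexAt G hi = vertexAt G hs
    · rw [he]
      exact ⟨p, hp⟩
    · have hadj : (underlyingGraph G u m).Adj (vertexAt G hi) (vertexAt G hs) :=
        ⟨he, _, _, rfl, Or.inl hE⟩
      exact ⟨.cons hadj p, by simp [hxi, hp]⟩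

/-! ### Complete returns are palindromes -/

/-- Let `factorAt u i k` be special and let the next occurrence of a word of its class be at
`i + d`. The walk of `u` from `i` to `i + d` is a loop of the graph of symmetries, or it leaves and
re-enters its first vertex through the same edge of the tree. In the second case the edge is
traversed in opposite directions, so that an antimorphism maps a longer prefix to a suffix. -/
theorem palindrome_or_longer (hG : IsSymmetryGroup G) {k i d : ℕ} (hcl : ClosedUnder G u)
    (hloop : LoopsArePalindromes G u k) (htree : LooplessIsTree G u k)
    (hd : 0 < d) (hi : IsSpecial u (factorAt u i k))
    (hj : factorAt u (i + d) k ∈ gClass G (factorAt u i k))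
    (hn : ∀ x, 0 < x → x < d → factorAt u (i + x) k ∉ gClass G (factorAt u i k)) :
    IsGPalindrome G (factorAt u i (d + k)) ∨
      ∃ s, 0 < s ∧ s < d ∧ ∃ Θ ∈ G, IsAntimorphism Θ ∧
        Θ (factorAt u i (k + s)) = factorAt u (i + (d - s)) (k + s) := by
  classical
  have hjs : IsSpecial u (factorAt u (i + d) k) := by
    obtain ⟨μ, hμ, h⟩ := hj
    rw [h]
    exact hG.isSpecial_map hcl hμ hi
  have hv : vertexAt G hjs = vertexAt G hi := Subtype.ext (gClass_eq_of_mem hj)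
  -- the first special position after `i`
  have hex : ∃ s, 0 < s ∧ IsSpecial u (factorAt u (i + s) k) := ⟨d, hd, hjs⟩
  obtain ⟨hs0, hs⟩ := Nat.find_spec hex
  have hsd : Nat.find hex ≤ d := Nat.find_min' hex ⟨hd, hjs⟩
  have hsmin : ∀ y, 0 < y → y < Nat.find hex → ¬ IsSpecial u (factorAt u (i + y) k) :=
    fun y hy hlt h => Nat.find_min hex hlt ⟨hy, h⟩
  generalize Nat.find hex = s at hs0 hs hsd hsmin
  rcases hsd.eq_or_lt with rfl | hsd
  · left
    have := startsEnds_factorAt (G := G) hs0 hi hjs hsmin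
    rw [hv] at this
    exact hloop _ _ this
  right
  -- the last special position before `i + d`, at distance `r` from it
  have hex' : ∃ r, 0 < r ∧ r ≤ d ∧ IsSpecial u (factorAt u (i + (d - r)) k) :=
    ⟨d - s, by omega, by omega, by rwa [Nat.sub_sub_self hsd.le]⟩
  obtain ⟨hr0, hrd, hr⟩ := Nat.find_spec hex'
  have hrs : Nat.find hex' ≤ d - s :=
    Nat.find_min' hex' ⟨by omega, by omega, by rwa [Nat.sub_sub_self hsd.le]⟩
  have hrmin : ∀ r', 0 < r' → r' < Nat.find hex' →
      ¬ IsSpecial u (factorAt u (i + (d - r')) k) :=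
    fun y hy hlt h => Nat.find_min hex' hlt ⟨hy, by omega, h⟩
  generalize Nat.find hex' = r at hr0 hrd hr hrs hrmin
  obtain ⟨t, rfl⟩ := Nat.exists_eq_add_of_le' hrd
  rw [Nat.add_sub_cancel] at hr
  obtain ⟨c, rfl⟩ : ∃ c, t = s + c := Nat.exists_eq_add_of_le (by omega)
  have he := startsEnds_factorAt (G := G) hs0 hi hs hsmin
  have hjs' : IsSpecial u (factorAt u (i + (s + c) + r) k) := by rwa [add_assoc i]
  have hv' : vertexAt G hjs' = vertexAt G hi := by
    rw [← hv]; simp only [vertexAt, add_assoc]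
  have he' := startsEnds_factorAt (G := G) hr0 hr hjs' fun y hy hyr => by
    have := hrmin (r - y) (by omega) (by omega)
    rwa [show i + (s + c + r - (r - y)) = i + (s + c) + y by omega] at this
  rw [hv'] at he'
  have hne : ∀ {y} (hy : IsSpecial u (factorAt u (i + y) k)), 0 < y → y < s + c + r →
      vertexAt G hy ≠ vertexAt G hi := fun {y} hy h0 h1 h => by
    apply hn y h0 h1
    rw [← show gClass G (factorAt u (i + y) k) = gClass G (factorAt u i k) from
      congrArg Subtype.val h]
    exact self_mem_gClass _
  have hr' : IsSpecial u (factorAt u (i + s + c) k) := by rwa [add_assoc]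
  have hvr : vertexAt G hr' = vertexAt G hr := by simp only [vertexAt, add_assoc]
  obtain ⟨p, hp⟩ := exists_walk_avoiding (vertexAt G hi) c hs hr' fun y hy => by
    rw [add_assoc]; exact hn _ (by omega) (by omega)
  have hadj : (underlyingGraph G u k).Adj (vertexAt G hs) (vertexAt G hi) :=
    ⟨hne hs hs0 hsd, _, _, rfl, Or.inr he⟩
  have hadj' : (underlyingGraph G u k).Adj (vertexAt G hi) (vertexAt G hr') := by
    rw [hvr]
    exact ⟨(hne hr (by omega) (by omega)).symm, _, _, rfl, Or.inr he'⟩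
  have hvs := eq_of_walk_avoiding htree.2.2 hadj hadj' p hp
  rw [hvr] at hvs
  rw [← hvs] at he'
  have hEE := htree.1 _ _ _ _ (hne hs hs0 hsd).symm ⟨_, rfl, Or.inl he⟩ ⟨_, rfl, Or.inr he'⟩
  have hmem := self_mem_gClass (G := G) (factorAt u (i + (s + c)) (r + k))
  rw [← hEE] at hmem
  obtain ⟨μ, hμ, hμe⟩ := hmem
  have hrs' : r = s := by
    have := congrArg List.length hμe
    rw [hG.length_map hμ, length_factorAt, length_factorAt] at this
    omega
  subst hrs'
  rw [add_comm r k] at hμe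
  refine ⟨r, hs0, hsd, μ, hμ, ?_, by rw [Nat.add_sub_cancel, ← hμe]⟩
  -- a morphism would create an inner occurrence of the class of the first vertex
  refine (hG.morphism_or_antimorphism μ hμ).resolve_left fun hm => ?_
  exact hn (r + c) (by omega) (by omega)
    ⟨μ, hμ, (hG.morphism_split hμ hm hμe.symm).1.symm⟩

/-- A word of the class of a longer prefix contains a word of the class of the
prefix, at one of its two ends. -/
theorem no_inner_occurrence (hG : IsSymmetryGroup G) {k i d s : ℕ} (hsd : s ≤ d)
    (hn : ∀ x, 0 < x → x < d → factorAt u (i + x) k ∉ gClass G (factorAt u i k)) :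
    ∀ x, 0 < x → x < d - s →
      factorAt u (i + x) (k + s) ∉ gClass G (factorAt u i (k + s)) := by
  rintro x hx hxd ⟨μ, hμ, h⟩
  rcases hG.morphism_or_antimorphism μ hμ with hm | hm
  · exact hn x hx (by omega) ⟨μ, hμ, (hG.morphism_split hμ hm h.symm).1.symm⟩
  · refine hn (x + s) (by omega) (by omega) ⟨μ, hμ, ?_⟩
    rw [← add_assoc]
    exact (hG.antimorphism_split hμ hm h.symm).1.symm

/-- If an antimorphism of `G` maps a prefix of length `k` of `factorAt u i (d + k)` to the suffix
and the class of the prefix does not occur in between, the word is a `G`-palindrome: a prefix that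
cannot be prolonged by one letter with the same antimorphism is special, and then
`palindrome_or_longer` prolongs it. -/
theorem isGPalindrome_of_antimorphism (hG : IsSymmetryGroup G) {N : ℕ}
    (htls : PropertyTls G N u) {i : ℕ} (d : ℕ) :
    ∀ {k : ℕ}, N ≤ k → 0 < d → ∀ Θ ∈ G, IsAntimorphism Θ →
      Θ (factorAt u i k) = factorAt u (i + d) k →
      (∀ x, 0 < x → x < d → factorAt u (i + x) k ∉ gClass G (factorAt u i k)) →
      IsGPalindrome G (factorAt u i (d + k)) := by
  induction d using Nat.strong_induction_on with
  | _ d ih =>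
    intro k hk hd Θ hΘ ha h hn
    obtain ⟨hcl, hloop, htree⟩ := htls k hk
    have key : ∀ s, 0 < s → s ≤ d → ∀ Θ' ∈ G, IsAntimorphism Θ' →
        Θ' (factorAt u i (k + s)) = factorAt u (i + (d - s)) (k + s) →
        IsGPalindrome G (factorAt u i (d + k)) := by
      intro s hs hsd Θ' hΘ' ha' h'
      rcases hsd.eq_or_lt with rfl | hlt
      · rw [Nat.sub_self, add_zero, add_comm k s] at h'
        exact ⟨Θ', hΘ', ha', h'⟩
      · have := ih (d - s) (by omega) (k := k + s) (by omega) (by omega) Θ' hΘ' ha' h'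
          (no_inner_occurrence hG hsd hn)
        rwa [show d - s + (k + s) = d + k by omega] at this
    obtain ⟨d, rfl⟩ := Nat.exists_eq_add_of_le' hd
    obtain ⟨b, hb⟩ := hG.exists_letter (G.inv_mem hΘ) (u (i + d))
    -- the prefix is followed by `b` in the preimage of the suffix prolonged to the left
    have hext : Θ⁻¹ (factorAt u (i + d) (k + 1)) = factorAt u i k ++ [b] := by
      rw [factorAt_succ', ← List.singleton_append, ha.inv, hb, add_assoc, ← h,
        Equiv.Perm.coe_inv, Equiv.symm_apply_apply]
    by_cases hbu : b = u (i + k)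
    · refine key 1 one_pos (by omega) Θ hΘ ha ?_
      rw [factorAt_succ, ← hbu, ← hext]
      simp
    · have hsp : IsSpecial u (factorAt u i k) := by
        refine ⟨factorAt_mem_language _ _ _, Or.inr ⟨b, ?_, u (i + k), ?_, hbu⟩⟩
        · change _ ∈ language u
          rw [← hext]
          exact hcl _ (factorAt_mem_language _ _ _) _ (G.inv_mem hΘ)
        · change _ ∈ language u
          rw [← factorAt_succ]
          exact factorAt_mem_language _ _ _
      rcases palindrome_or_longer hG hcl hloop htree hd hsp ⟨Θ, hΘ, h.symm⟩ hn with
        hp | ⟨s, hs, hsd, Θ', hΘ', ha', h'⟩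
      · exact hp
      · exact key s hs hsd.le Θ' hΘ' ha' h'

/-- Complete returns to the class of a special factor of length at least `N` are
`G`-palindromes. -/
theorem isGPalindrome_of_return (hG : IsSymmetryGroup G) {N : ℕ} (htls : PropertyTls G N u)
    {i d k : ℕ} (hk : N ≤ k) (hd : 0 < d) (hi : IsSpecial u (factorAt u i k))
    (hj : factorAt u (i + d) k ∈ gClass G (factorAt u i k))
    (hn : ∀ x, 0 < x → x < d → factorAt u (i + x) k ∉ gClass G (factorAt u i k)) :
    IsGPalindrome G (factorAt u i (d + k)) := by
  obtain ⟨hcl, hloop, htree⟩ := htls k hk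
  rcases palindrome_or_longer hG hcl hloop htree hd hi hj hn with
    hp | ⟨s, hs, hsd, Θ, hΘ, ha, h⟩
  · exact hp
  · have := isGPalindrome_of_antimorphism hG htls (d - s) (k := k + s) (by omega) (by omega)
      Θ hΘ ha h (no_inner_occurrence hG hsd.le hn)
    rwa [show d - s + (k + s) = d + k by omega] at this

/-! ### Generation by involutive antimorphisms -/

/-- If `w` is special, contains all letters and is long enough, then any two occurrences of
words of the class of `w` differ by an element of the group generated by the involutive
antimorphisms. -/
theorem exists_mem_closure_map_eq (hG : IsSymmetryGroup G) {N : ℕ} (htls : PropertyTls G N u)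
    {k : ℕ} (hk : N ≤ k) (d : ℕ) :
    ∀ {i : ℕ}, IsSpecial u (factorAt u i k) → (∀ a, a ∈ factorAt u i k) →
      factorAt u (i + d) k ∈ gClass G (factorAt u i k) →
      ∃ h ∈ Subgroup.closure (involutiveAntimorphisms G),
        h (factorAt u i k) = factorAt u (i + d) k := by
  classical
  induction d using Nat.strong_induction_on with
  | _ d ih =>
    intro i hi hfull hj
    rcases Nat.eq_zero_or_pos d with rfl | hd
    · exact ⟨1, one_mem _, rfl⟩
    have hex : ∃ s, 0 < s ∧ factorAt u (i + s) k ∈ gClass G (factorAt u i k) := ⟨d, hd, hj⟩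
    obtain ⟨hs0, hs⟩ := Nat.find_spec hex
    have hsd : Nat.find hex ≤ d := Nat.find_min' hex ⟨hd, hj⟩
    have hmin : ∀ y, 0 < y → y < Nat.find hex →
        factorAt u (i + y) k ∉ gClass G (factorAt u i k) :=
      fun y hy hlt h => Nat.find_min hex hlt ⟨hy, h⟩
    generalize Nat.find hex = s at hs0 hs hsd hmin
    obtain ⟨Θ, hΘ, ha, hpal⟩ := isGPalindrome_of_return hG htls hk hs0 hi hs hmin
    have hΘI : Θ ∈ Subgroup.closure (involutiveAntimorphisms G) := by
      refine hG.mem_closure_of_fixes hΘ (fun a => ?_) hpal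
      rw [add_comm, factorAt_add]
      exact List.mem_append_left _ (hfull a)
    rw [add_comm s k] at hpal
    have hΘw := (hG.antimorphism_split hΘ ha hpal).1
    obtain ⟨c, rfl⟩ := Nat.exists_eq_add_of_le hsd
    have hcl := (htls k hk).1
    obtain ⟨h, hh, e⟩ := ih c (by omega) (i := i + s)
      (hΘw ▸ hG.isSpecial_map hcl hΘ hi) (hΘw ▸ hG.forall_mem_map hΘ hfull)
      (by rwa [add_assoc, gClass_eq_of_mem hs])
    refine ⟨h * Θ, mul_mem hh hΘI, ?_⟩
    rw [Equiv.Perm.mul_apply, hΘw, e, add_assoc]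

/-- If no special factor of length at least `n` contains all letters, then `factorAt u 0 n`
determines all its right prolongations, and every antimorphism of `G` is an involution. -/
theorem mem_involutiveAntimorphisms_of_not_special (hG : IsSymmetryGroup G)
    (hcl : ClosedUnder G u) {n : ℕ} (hfull : ∀ a, a ∈ factorAt u 0 n)
    (hns : ∀ i k, n ≤ k → (∀ a, a ∈ factorAt u i k) → ¬ IsSpecial u (factorAt u i k))
    {Θ : Equiv.Perm (List A)} (hΘ : Θ ∈ G) (ha : IsAntimorphism Θ) :
    Θ ∈ involutiveAntimorphisms G := by
  have hdet : ∀ i, factorAt u i n = factorAt u 0 n → ∀ d,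
      factorAt u i (n + d) = factorAt u 0 (n + d) := by
    intro i hi d
    induction d with
    | zero => exact hi
    | succ d ih =>
      by_contra hne
      refine hns 0 (n + d) (by omega) (fun a => ?_) ⟨factorAt_mem_language _ _ _, Or.inr
        ⟨u (i + (n + d)), ?_, u (0 + (n + d)), ?_, fun h => hne ?_⟩⟩
      · rw [factorAt_add]
        exact List.mem_append_left _ (hfull a)
      · change _ ∈ language u
        rw [← ih, ← factorAt_succ]
        exact factorAt_mem_language _ _ _
      · change _ ∈ language u
        rw [← factorAt_succ]
        exact factorAt_mem_language _ _ _
      · rw [← add_assoc, factorAt_succ, factorAt_succ, ih, h]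
  obtain ⟨d, hd⟩ := hG.exists_factorAt hcl hΘ 0 n
  -- the prefix ending with `Θ (factorAt u 0 n)` is fixed, as its preimage has the same beginning
  obtain ⟨j, hj⟩ := hG.exists_factorAt hcl (G.inv_mem hΘ) 0 (d + n)
  have hj' := (hG.antimorphism_split (G.inv_mem hΘ) ha.inv hj).2
  rw [Nat.zero_add, ← hd, Equiv.Perm.coe_inv, Equiv.symm_apply_apply] at hj'
  have hfix := hj
  rw [add_comm d n, hdet j hj'.symm d] at hfix
  refine hG.mem_involutiveAntimorphisms hΘ ha (w := factorAt u 0 (n + d)) (fun a => ?_) ?_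
  · rw [factorAt_add]
    exact List.mem_append_left _ (hfull a)
  · exact (Equiv.Perm.inv_eq_iff_eq.1 hfix).symm

end GRich

theorem mainTheorem4 {A : Type*} [Finite A] (G : Subgroup (Equiv.Perm (List A)))
    (hG : GRich.IsSymmetryGroup G)
    (h : ∃ u : ℕ → A, Function.Surjective u ∧ GRich.IsAlmostRich G u) :
    Subgroup.closure (GRich.involutiveAntimorphisms G) = G := by
  open GRich in
  obtain ⟨u, hu, N, htls⟩ := h
  have hcl := (htls N le_rfl).1
  refine le_antisymm ((Subgroup.closure_le _).2 fun Θ hΘ => hΘ.1) fun μ hμ => ?_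
  obtain ⟨n, hNn, hfull⟩ := exists_forall_mem_factorAt hu N
  by_cases hsp : ∃ i k, n ≤ k ∧ (∀ a, a ∈ factorAt u i k) ∧ IsSpecial u (factorAt u i k)
  · obtain ⟨i, k, hk, hw, hi⟩ := hsp
    obtain ⟨l, hl⟩ := hG.exists_factorAt hcl hμ i k
    obtain ⟨j, hij, hj⟩ := hG.exists_occurrence hcl i l k
    obtain ⟨d, rfl⟩ := Nat.exists_eq_add_of_le hij
    rw [← hl] at hj
    obtain ⟨h, hh, e⟩ := exists_mem_closure_map_eq hG htls (hNn.trans hk) d hi hw ⟨μ, hμ, hj⟩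
    have hhG : h ∈ G := (Subgroup.closure_le _).2 (fun Θ hΘ => hΘ.1) hh
    have := hG.mem_closure_of_fixes (G.mul_mem (G.inv_mem hhG) hμ) hw (by
      rw [Equiv.Perm.mul_apply, ← hj, ← e, Equiv.Perm.coe_inv, Equiv.symm_apply_apply])
    simpa using mul_mem hh this
  · push Not at hsp
    have hanti : ∀ Θ ∈ G, IsAntimorphism Θ →
        Θ ∈ Subgroup.closure (involutiveAntimorphisms G) := fun Θ hΘ ha =>
      Subgroup.subset_closure (mem_involutiveAntimorphisms_of_not_special hG hcl hfull hsp hΘ ha)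
    rcases hG.morphism_or_antimorphism μ hμ with hm | ha
    -- a morphism is the product of two antimorphisms
    · obtain ⟨Θ, hΘ, ha⟩ := hG.exists_antimorphism
      have h1 := hanti (Θ * μ) (G.mul_mem hΘ hμ) fun v w => by
        simp only [Equiv.Perm.mul_apply]
        rw [hm, ha]
      simpa using mul_mem (inv_mem (hanti Θ hΘ ha)) h1
    · exact hanti μ hμ ha
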